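/- Let $N$ users choose investments $x_1,\dots,x_N\ge 0$. User $i$ has a unit cost $c_i>0$ and a risk function $f_i$ on $[0,\infty)^N$ that is positive and differentiable, with $\partial f_i/\partial x_j<0$ for all $j$ (derivatives at the boundary being one-sided), and strictly convex in $x_i$ for any fixed $\mathbf{x}_{-i}\succeq 0$ (as is the case, in particular, if $f_i$ is strictly convex on $[0,\infty)^N$). The utility of user $i$ is $u_i(\mathbf{x})=-f_i(\mathbf{x})-c_ix_i-t_i(\mathbf{x})$, where $t_i$ is a monetary transfer. Then the unregulated interdependent security (IDS) game, i.e. the game with strategy sets $[0,\infty)$, utilities $u_i$ and $t_i=0$ for all $i$, always has a pure strategy Nash equilibrium: there is $\bar{\mathbf{x}}\in[0,\infty)^N$ such that \[u_i(\bar x_i,\bar{\mathbf{x}}_{-i})\ \ge\ u_i(x_i,\bar{\mathbf{x}}_{-i})\qquad\text{for all } x_i\ge 0 \text{ and all } i.\] -/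

import Mathlib

/-- The joint strategy space: investment profiles with `x j ≥ 0` for every user `j`. -/
def investmentProfiles (N : ℕ) : Set (Fin N → ℝ) := {x | ∀ j, 0 ≤ x j}

/-- The model of an interdependent security (IDS) game among `N` users: unit investment costs `c i`
and security risk functions `f i`. Only the values of `f i` on nonnegative profiles matter, and all
the assumptions are made there only; at a boundary point derivatives are one-sided. -/
structure IDSGame (N : ℕ) where
  /-- cost per unit of investment -/
  c : Fin N → ℝ
  /-- security risk functions -/
  f : Fin N → (Fin N → ℝ) → ℝ
  c_pos : ∀ i, 0 < c i
  f_pos : ∀ i, ∀ x ∈ investmentProfiles N, 0 < f i x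
  f_differentiable : ∀ i, DifferentiableOn ℝ (f i) (investmentProfiles N)
  /-- positive externalities: `∂ f i / ∂ x j < 0` for all `i` and `j` -/
  f_decreasing : ∀ i j, ∀ x ∈ investmentProfiles N,
    derivWithin (fun y : ℝ => f i (Function.update x j y)) (Set.Ici 0) (x j) < 0
  /-- `f i` is strictly convex in the user's own investment, for all fixed investments of the
  others. Strict convexity of `f i` on the whole set of nonnegative profiles implies this, and so
  does a total effort model `f i x = F (∑ j, x j)` with `F` strictly convex, which is not jointly
  strictly convex if `N ≥ 2`. -/
  f_strictConvex : ∀ i, ∀ x ∈ investmentProfiles N,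
    StrictConvexOn ℝ (Set.Ici 0) (fun y : ℝ => f i (Function.update x i y))

/-- The utility of user `i` under monetary transfers `t`, which may depend on the investments:
`u i x = - f i x - c i * x i - t i x`. -/
def IDSGame.utility {N : ℕ} (G : IDSGame N) (t : Fin N → (Fin N → ℝ) → ℝ)
    (i : Fin N) (x : Fin N → ℝ) : ℝ :=
  -G.f i x - G.c i * x i - t i x

/-- A pure strategy Nash equilibrium of the game with strategy sets `[0, ∞)` and utilities `u`. -/
def IsPureNashEquilibrium {N : ℕ} (u : Fin N → (Fin N → ℝ) → ℝ) (x : Fin N → ℝ) : Prop :=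
  x ∈ investmentProfiles N ∧
    ∀ i, ∀ y : ℝ, 0 ≤ y → u i (Function.update x i y) ≤ u i x

/-! Risk is positive and decreasing, so investing more than `f i 0 / c i` costs user `i` more than
investing nothing; only a compact box of profiles matters. There strict convexity makes each best
response unique, hence continuous, and a Brouwer fixed point of the joint best response is an
equilibrium. Brouwer is proved analytically. If `G` is Lipschitz and vanishes off a ball, `id + t •
G` permutes the ball for small `t`, so its Jacobian determinant integrates to the volume. The
integrand is polynomial in `t`, so this persists at `t = 1`, whereas a retraction onto the sphere
would give integral zero. -/

/-! ### Jacobian integrals of Lipschitz perturbations of the identity. -/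

theorem ContinuousLinearMap.det_one_add_pos_of_norm_lt_one {E : Type*} [NormedAddCommGroup E]
    [NormedSpace ℝ E] [FiniteDimensional ℝ E] (A : E →L[ℝ] E) (hA : ‖A‖ < 1) :
    0 < (1 + A).det := by
  -- Invertibility along the whole segment (Neumann series) keeps the determinant from changing sign
  -- after its value 1 at `t = 0`.
  have hne : ∀ t ∈ Set.Icc (0 : ℝ) 1, (1 + t • A).det ≠ 0 := by
    intro t ht h0
    have hlt : ‖-(t • A)‖ < 1 := by
      rw [norm_neg, norm_smul, Real.norm_of_nonneg ht.1]
      nlinarith [norm_nonneg A, ht.2]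
    have hu := isUnit_one_sub_of_norm_lt_one hlt
    rw [sub_neg_eq_add] at hu
    obtain ⟨B, hB⟩ := hu.exists_right_inv
    have := congrArg ContinuousLinearMap.det hB
    simp [ContinuousLinearMap.det, ContinuousLinearMap.toLinearMap_mul, map_mul] at this h0
    simp [h0] at this
  have hcont : Continuous fun t : ℝ => (1 + t • A).det :=
    ContinuousLinearMap.continuous_det.comp (by fun_prop)
  by_contra! hle
  obtain ⟨t, ht, h0⟩ := isPreconnected_Icc.intermediate_value (s := Set.Icc (0 : ℝ) 1)
    (Set.right_mem_Icc.2 zero_le_one) (Set.left_mem_Icc.2 zero_le_one) hcont.continuousOn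
    (show (0 : ℝ) ∈ Set.Icc ((1 + (1 : ℝ) • A).det) ((1 + (0 : ℝ) • A).det) by
      refine ⟨by simpa using hle, ?_⟩
      simp [ContinuousLinearMap.det])
  exact hne t ht h0

open Polynomial in
theorem LinearMap.exists_polynomial_eval_eq_det_one_add_smul {E : Type*} [AddCommGroup E]
    [Module ℝ E] [FiniteDimensional ℝ E] (A : E →ₗ[ℝ] E) :
    ∃ p : ℝ[X], p.natDegree ≤ Module.finrank ℝ E ∧
      ∀ t : ℝ, p.eval t = LinearMap.det (1 + t • A) := by
  let b := Module.finBasis ℝ E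
  let M := LinearMap.toMatrix b b A
  refine ⟨Matrix.det ((X : ℝ[X]) • M.map C + (1 : Matrix _ _ ℝ).map C), ?_, fun t => ?_⟩
  · simpa using Polynomial.natDegree_det_X_add_C_le M 1
  · rw [← LinearMap.det_toMatrix b, ← Polynomial.coe_evalRingHom, RingHom.map_det]
    congr 1
    ext i j
    by_cases hij : i = j <;>
      simp [M, hij, LinearMap.toMatrix_one] <;> ring

-- Lagrange interpolation. The weights do not depend on `p`, so they can be pulled out of an
-- integral over a family of polynomials.
open Polynomial in
theorem Polynomial.exists_weights_eval_eq_sum (n : ℕ) {v : ℕ → ℝ} (hv : Function.Injective v)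
    (a : ℝ) : ∃ w : ℕ → ℝ, ∀ p : ℝ[X], p.natDegree ≤ n →
      p.eval a = ∑ j ∈ Finset.range (n + 1), w j * p.eval (v j) := by
  refine ⟨fun j => (Lagrange.basis (Finset.range (n + 1)) v j).eval a, fun p hp => ?_⟩
  have h := Lagrange.eq_interpolate (s := Finset.range (n + 1)) (v := v) (f := p) hv.injOn
    (by
      rw [Finset.card_range]
      exact (Polynomial.degree_le_natDegree).trans_lt (by exact_mod_cast Nat.lt_succ_of_le hp))
  conv_lhs => rw [h]
  rw [Lagrange.interpolate_apply, Polynomial.eval_finsetSum]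
  exact Finset.sum_congr rfl fun j _ => by simp [mul_comm]

-- For `t * K < 1` the map `id + t • G` is a bijection of `E` fixing the complement of `s`, so it
-- maps `s` onto itself; change of variables applies.
open MeasureTheory Set in
theorem setIntegral_det_one_add_smul_of_lipschitz {E : Type*} [NormedAddCommGroup E]
    [NormedSpace ℝ E] [FiniteDimensional ℝ E] [MeasurableSpace E] [BorelSpace E]
    (μ : Measure E) [μ.IsAddHaarMeasure] {s : Set E} (hs : IsOpen s) (hμ : μ s ≠ ⊤)
    {G : E → E} {G' : E → E →L[ℝ] E} {K : NNReal} (hK : LipschitzWith K G)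
    (hG : ∀ x ∉ s, G x = 0) (hG' : ∀ x ∈ s, HasFDerivAt G (G' x) x) {t : ℝ} (ht : 0 ≤ t)
    (htK : t * K < 1) :
    IntegrableOn (fun x => (1 + t • G' x).det) s μ ∧
      ∫ x in s, (1 + t • G' x).det ∂μ = μ.real s := by
  set F : E → E := fun x => x + t • G x
  have hF' : ∀ x ∈ s, HasFDerivWithinAt F (1 + t • G' x) s x := fun x hx =>
    ((hasFDerivAt_id x).add ((hG' x hx).const_smul t)).hasFDerivWithinAt
  have hpos : ∀ x ∈ s, 0 < (1 + t • G' x).det := fun x hx => by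
    apply ContinuousLinearMap.det_one_add_pos_of_norm_lt_one
    rw [norm_smul, Real.norm_of_nonneg ht]
    exact (mul_le_mul_of_nonneg_left ((hG' x hx).le_of_lipschitz hK) ht).trans_lt htK
  let c : NNReal := t.toNNReal * K
  have hc : c < 1 := by
    rw [← NNReal.coe_lt_coe]; simpa [c, ht] using htK
  have hlip : LipschitzWith c (fun x => t • G x) := by
    refine LipschitzWith.of_dist_le_mul fun x y => ?_
    rw [dist_smul₀, Real.norm_of_nonneg ht]
    have := mul_le_mul_of_nonneg_left (hK.dist_le_mul x y) ht
    simpa [c, ht, mul_assoc] using this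
  have happ : ApproximatesLinearOn F ((ContinuousLinearEquiv.refl ℝ E : E ≃L[ℝ] E) : E →L[ℝ] E)
      univ c := by
    rw [ApproximatesLinearOn.approximatesLinearOn_iff_lipschitzOnWith, lipschitzOnWith_univ]
    convert hlip using 2
    simp [F]
  have hcN : Subsingleton E ∨
      c < ‖((ContinuousLinearEquiv.refl ℝ E).symm : E →L[ℝ] E)‖₊⁻¹ := by
    rcases subsingleton_or_nontrivial E with h | h
    · exact Or.inl h
    · right
      have : ‖((ContinuousLinearEquiv.refl ℝ E).symm : E →L[ℝ] E)‖₊ = 1 := by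
        ext; exact ContinuousLinearMap.norm_id
      rwa [this, inv_one]
  have hinj : Function.Injective F := injOn_univ.1 (happ.injOn hcN)
  have hsurj : Function.Surjective F := happ.surjective hcN
  have hfix : ∀ x ∉ s, F x = x := fun x hx => by simp [F, hG x hx]
  have himage : F '' s = s := by
    ext y
    constructor
    · rintro ⟨x, hx, rfl⟩
      by_contra hy
      exact hy (by rwa [hinj (hfix _ hy)])
    · intro hy
      obtain ⟨z, rfl⟩ := hsurj y
      refine ⟨z, ?_, rfl⟩
      by_contra hz
      exact hz (by rwa [hfix z hz] at hy)
  have hint := (integrableOn_image_iff_integrableOn_abs_det_fderiv_smul μ hs.measurableSet hF'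
    hinj.injOn (fun _ => (1 : ℝ)))
  have heq := integral_image_eq_integral_abs_det_fderiv_smul μ hs.measurableSet hF'
    hinj.injOn (fun _ => (1 : ℝ))
  rw [himage] at hint heq
  have hcongr : EqOn (fun x => |(1 + t • G' x).det| • (1 : ℝ)) (fun x => (1 + t • G' x).det) s :=
    fun x hx => by simp [abs_of_pos (hpos x hx)]
  constructor
  · exact (hint.1 (integrableOn_const hμ)).congr_fun hcongr hs.measurableSet
  · rw [← setIntegral_congr_fun hs.measurableSet hcongr, ← heq]
    simp

open MeasureTheory Set in
/-- A Lipschitz perturbation of the identity which is the identity off an open set `s` of finite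
measure has Jacobian determinant of average one on `s`. -/
theorem setIntegral_det_one_add_of_lipschitz {E : Type*} [NormedAddCommGroup E]
    [NormedSpace ℝ E] [FiniteDimensional ℝ E] [MeasurableSpace E] [BorelSpace E]
    (μ : Measure E) [μ.IsAddHaarMeasure] {s : Set E} (hs : IsOpen s) (hμ : μ s ≠ ⊤)
    {G : E → E} {G' : E → E →L[ℝ] E} {K : NNReal} (hK : LipschitzWith K G)
    (hG : ∀ x ∉ s, G x = 0) (hG' : ∀ x ∈ s, HasFDerivAt G (G' x) x) :
    ∫ x in s, (1 + G' x).det ∂μ = μ.real s := by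
  -- Distinct interpolation nodes, all small enough that `v j * K < 1`.
  let v : ℕ → ℝ := fun j => 1 / ((j + 1) * (K + 1))
  have hK0 : (0 : ℝ) ≤ K := K.2
  have hv0 : ∀ j, 0 ≤ v j := fun j => by positivity
  have hvK : ∀ j, v j * K < 1 := fun j => by
    have hj : (0 : ℝ) ≤ j := j.cast_nonneg
    have : (0 : ℝ) < (j + 1) * (K + 1) := by positivity
    simp only [v]
    rw [one_div_mul_eq_div, div_lt_one this]
    nlinarith
  have hv : Function.Injective v := fun i j hij => by
    have hK1 : (K + 1 : ℝ) ≠ 0 := by positivity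
    simp only [v, one_div, inv_inj] at hij
    have := mul_right_cancel₀ hK1 hij
    exact_mod_cast add_right_cancel this
  obtain ⟨w, hw⟩ := Polynomial.exists_weights_eval_eq_sum (Module.finrank ℝ E) hv 1
  have hdet : ∀ A : E →L[ℝ] E, (1 + A).det =
      ∑ j ∈ Finset.range (Module.finrank ℝ E + 1), w j * (1 + v j • A).det := by
    intro A
    obtain ⟨p, hp, hpe⟩ :=
      LinearMap.exists_polynomial_eval_eq_det_one_add_smul (A : E →ₗ[ℝ] E)
    have := hw p hp
    simp only [hpe, one_smul] at this
    exact this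
  have hone : ∑ j ∈ Finset.range (Module.finrank ℝ E + 1), w j = 1 := by
    have := hw 1 (by simp)
    simpa using this.symm
  have key := fun j => setIntegral_det_one_add_smul_of_lipschitz μ hs hμ hK hG hG' (hv0 j) (hvK j)
  calc ∫ x in s, (1 + G' x).det ∂μ
      = ∫ x in s, ∑ j ∈ Finset.range (Module.finrank ℝ E + 1),
          w j * (1 + v j • G' x).det ∂μ := by simp_rw [← hdet]
    _ = ∑ j ∈ Finset.range (Module.finrank ℝ E + 1), w j * μ.real s := by
      rw [integral_finsetSum _ fun j _ => (key j).1.const_mul (w j)]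
      exact Finset.sum_congr rfl fun j _ => by rw [integral_const_mul, (key j).2]
    _ = μ.real s := by rw [← Finset.sum_mul, hone, one_mul]

/-! ### Brouwer's fixed point theorem. -/

-- A segment leaving the ball crosses the sphere, where `G` already vanishes.
open Set Metric in
theorem LipschitzOnWith.lipschitzWith_of_eq_zero_off_ball {E F : Type*} [NormedAddCommGroup E]
    [NormedSpace ℝ E] [NormedAddCommGroup F] {G : E → F} {R : ℝ} {K : NNReal}
    (hK : LipschitzOnWith K G (closedBall 0 R)) (hG : ∀ x ∉ ball (0 : E) R, G x = 0) :
    LipschitzWith K G := by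
  have aux : ∀ x ∈ ball (0 : E) R, ∀ y ∉ ball (0 : E) R, dist (G x) (G y) ≤ K * dist x y := by
    intro x hx y hy
    rw [mem_ball_zero_iff] at hx hy
    have hcont : Continuous fun s : ℝ => ‖AffineMap.lineMap x y s‖ :=
      (AffineMap.lineMap_continuous (p := x) (q := y)).norm
    obtain ⟨s, hs, hsR⟩ := intermediate_value_Icc (zero_le_one' ℝ) hcont.continuousOn
      (show R ∈ Icc _ _ by simpa using ⟨hx.le, not_lt.1 hy⟩)
    set z : E := AffineMap.lineMap x y s with hz
    have hsR : ‖z‖ = R := hsR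
    have hGz : G z = 0 := hG z (by simp [hsR])
    have hGy : G y = 0 := hG y (by simpa using hy)
    calc dist (G x) (G y) = dist (G x) (G z) := by rw [hGy, hGz]
      _ ≤ K * dist x z := hK.dist_le_mul x (by simpa using hx.le) z (by simp [hsR])
      _ ≤ K * dist x y := by
        gcongr
        rw [hz, dist_left_lineMap, Real.norm_of_nonneg hs.1]
        exact mul_le_of_le_one_left dist_nonneg hs.2
  refine LipschitzWith.of_dist_le_mul fun x y => ?_
  by_cases hx : x ∈ ball (0 : E) R <;> by_cases hy : y ∈ ball (0 : E) R
  · exact hK.dist_le_mul x (ball_subset_closedBall hx) y (ball_subset_closedBall hy)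
  · exact aux x hx y hy
  · rw [dist_comm, dist_comm x]
    exact aux y hy x hx
  · rw [hG x hx, hG y hy, dist_self]
    positivity

open Set Metric in
theorem ContDiff.exists_lipschitzOnWith_closedBall {E F : Type*} [NormedAddCommGroup E]
    [NormedSpace ℝ E] [FiniteDimensional ℝ E] [NormedAddCommGroup F] [NormedSpace ℝ F]
    {G : E → F} (hG : ContDiff ℝ 1 G) (R : ℝ) :
    ∃ K, LipschitzOnWith K G (closedBall 0 R) := by
  obtain ⟨C, hC⟩ := (isCompact_closedBall (0 : E) R).exists_bound_of_continuousOn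
    (hG.continuous_fderiv one_ne_zero).continuousOn
  refine ⟨C.toNNReal, (convex_closedBall 0 R).lipschitzOnWith_of_nnnorm_fderiv_le
    (fun x _ => (hG.differentiable one_ne_zero).differentiableAt) fun x hx => ?_⟩
  rw [← NNReal.coe_le_coe, coe_nnnorm]
  exact (hC x hx).trans (Real.le_coe_toNNReal C)

theorem ContinuousLinearMap.det_eq_zero_of_inner_eq_zero {E : Type*} [NormedAddCommGroup E]
    [InnerProductSpace ℝ E] [FiniteDimensional ℝ E] {A : E →L[ℝ] E} {v : E} (hv : v ≠ 0)
    (hA : ∀ w, inner ℝ v (A w) = 0) : A.det = 0 := by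
  by_contra h
  have hu : IsUnit (LinearMap.det (A : E →ₗ[ℝ] E)) := isUnit_iff_ne_zero.2 h
  have hsurj : Function.Surjective (A : E →ₗ[ℝ] E) :=
    ((Module.End.isUnit_iff _).1 ((LinearMap.isUnit_iff_isUnit_det _).2 hu)).2
  obtain ⟨w, hw⟩ := hsurj v
  have := hA w
  rw [show A w = v from hw] at this
  exact hv (inner_self_eq_zero.1 this)

-- Without fixed points, `x - f x` rescales to a map `P` into the sphere of radius `R`, equal to the
-- identity on that sphere because `f` vanishes there. Constant norm makes every derivative of `P`
-- singular, so the ball would have volume zero.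
open MeasureTheory Set Metric in
theorem ContDiff.exists_fixedPoint_of_eq_zero_off_ball {E : Type*} [NormedAddCommGroup E]
    [InnerProductSpace ℝ E] [FiniteDimensional ℝ E] {f : E → E} (hf : ContDiff ℝ 1 f) {R : ℝ}
    (hR : 0 < R) (hfR : ∀ x ∉ ball (0 : E) R, f x = 0) : ∃ x, f x = x := by
  by_contra! hne
  borelize E
  let μ : Measure E := Measure.addHaar
  set H : E → E := fun x => x - f x
  have hH0 : ∀ x, H x ≠ 0 := fun x h => hne x (sub_eq_zero.1 h).symm
  have hH : ContDiff ℝ 1 H := contDiff_id.sub hf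
  let P : E → E := fun x => (R / ‖H x‖) • H x
  have hP : ContDiff ℝ 1 P :=
    (contDiff_const.div (hH.norm ℝ hH0) fun x => norm_ne_zero_iff.2 (hH0 x)).smul hH
  have hPn : ∀ x, ‖P x‖ = R := fun x => by
    have := norm_ne_zero_iff.2 (hH0 x)
    simp only [P]
    rw [norm_smul, norm_div, norm_norm, Real.norm_of_nonneg hR.le]
    field_simp
  have hGs : ContDiff ℝ 1 fun x => P x - x := hP.sub contDiff_id
  let G : E → E := (ball (0 : E) R).indicator fun x => P x - x
  have hG0 : ∀ x ∉ ball (0 : E) R, G x = 0 := fun x hx => indicator_of_notMem hx _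
  have hGin : EqOn G (fun x => P x - x) (closedBall 0 R) := by
    intro x hx
    by_cases hxb : x ∈ ball (0 : E) R
    · exact indicator_of_mem hxb _
    · have hxR : ‖x‖ = R := le_antisymm (by simpa using hx) (by simpa using hxb)
      have hHx : H x = x := by simp [H, hfR x hxb]
      simp only [hG0 x hxb, P, hHx, hxR, div_self hR.ne', one_smul, sub_self]
  obtain ⟨K, hK⟩ := hGs.exists_lipschitzOnWith_closedBall R
  have hKG : LipschitzWith K G :=
    LipschitzOnWith.lipschitzWith_of_eq_zero_off_ball
      (fun x hx y hy => by rw [hGin hx, hGin hy]; exact hK hx hy) hG0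
  have hPd : ∀ x, HasFDerivAt P (fderiv ℝ P x) x := fun x =>
    (hP.differentiable one_ne_zero).differentiableAt.hasFDerivAt
  have hG' : ∀ x ∈ ball (0 : E) R, HasFDerivAt G (fderiv ℝ P x - 1) x := fun x hx =>
    ((hPd x).sub (hasFDerivAt_id x)).congr_of_eventuallyEq
      ((hGin.mono ball_subset_closedBall).eventuallyEq_of_mem (isOpen_ball.mem_nhds hx))
  have hdet : ∀ x, (fderiv ℝ P x).det = 0 := fun x => by
    refine ContinuousLinearMap.det_eq_zero_of_inner_eq_zero (v := P x)
      (norm_pos_iff.1 (by rw [hPn]; exact hR)) fun w => ?_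
    have h1 : HasFDerivAt (fun x => ‖P x‖ ^ 2) (0 : E →L[ℝ] ℝ) x := by
      simp only [hPn]
      exact hasFDerivAt_const _ _
    have h2 := congrArg (fun L : E →L[ℝ] ℝ => L w) ((hPd x).norm_sq.unique h1)
    simpa using h2
  have key := setIntegral_det_one_add_of_lipschitz μ isOpen_ball measure_ball_lt_top.ne hKG hG0 hG'
  simp only [add_sub_cancel, hdet, integral_zero] at key
  exact (ENNReal.toReal_pos (measure_ball_pos μ 0 hR).ne' measure_ball_lt_top.ne).ne key

open Set Metric in
/-- **Brouwer's fixed point theorem** for bounded continuous self-maps of a Euclidean space. -/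
theorem Continuous.exists_fixedPoint_of_bounded {E : Type*} [NormedAddCommGroup E]
    [InnerProductSpace ℝ E] [FiniteDimensional ℝ E] {f : E → E} (hf : Continuous f) {C : ℝ}
    (hC : ∀ x, ‖f x‖ ≤ C) : ∃ x, f x = x := by
  have hC0 : 0 ≤ C := (norm_nonneg _).trans (hC 0)
  have approx : ∀ ε : ℝ, 0 < ε → ε < 1 → ∃ x ∈ closedBall (0 : E) (C + 1), ‖f x - x‖ < ε := by
    intro ε hε hε1
    obtain ⟨g, hg, hgf, -⟩ := hf.exists_contDiff_approx 1 (continuous_const (y := ε)) fun _ => hε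
    -- The fixed point of `φ • g` has norm at most `C + 1`, where the cutoff is 1, so it is fixed by
    -- `g` itself.
    let φ : ContDiffBump (0 : E) := ⟨C + 1, C + 2, by linarith, by linarith⟩
    obtain ⟨x, hx⟩ := ContDiff.exists_fixedPoint_of_eq_zero_off_ball
      (f := fun x => φ x • g x) (φ.contDiff.smul hg) (R := C + 2) (by linarith)
      fun x hx => by
        have : φ x = 0 := φ.zero_of_le_dist (by simpa using hx)
        simp [this]
    have hgx : ‖g x‖ ≤ C + 1 := by
      have := norm_le_norm_add_norm_sub' (g x) (f x)
      have h2 := hgf x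
      rw [dist_eq_norm] at h2
      linarith [hC x]
    have hxC : x ∈ closedBall (0 : E) (C + 1) := by
      rw [mem_closedBall_zero_iff, ← hx, norm_smul, Real.norm_of_nonneg φ.nonneg]
      exact (mul_le_of_le_one_left (norm_nonneg _) φ.le_one).trans hgx
    have hφ : φ x = 1 := φ.one_of_mem_closedBall hxC
    rw [hφ, one_smul] at hx
    refine ⟨x, hxC, ?_⟩
    have h2 := hgf x
    rwa [hx, dist_eq_norm, norm_sub_rev] at h2
  obtain ⟨x, -, hx⟩ := (isCompact_closedBall (0 : E) (C + 1)).exists_isMinOn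
    ⟨0, by simp; linarith⟩ (hf.sub continuous_id).norm.continuousOn
  refine ⟨x, ?_⟩
  by_contra hne
  have hpos : 0 < ‖f x - x‖ := norm_pos_iff.2 (sub_ne_zero.2 hne)
  obtain ⟨y, hy, hyx⟩ := approx (min ‖f x - x‖ (1 / 2)) (lt_min hpos (by norm_num))
    ((min_le_right _ _).trans_lt (by norm_num))
  exact absurd (hx hy) (not_le.2 (hyx.trans_le (min_le_left _ _)))

/-! ### Equilibria of strictly convex games on a box. -/

-- Off a neighbourhood of the unique minimizer the strict inequality holds on a compact set, hence
-- persists for nearby parameters.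
open Set Topology in
theorem continuous_of_unique_isMinOn {X Y : Type*} [TopologicalSpace X] [TopologicalSpace Y]
    {K : Set Y} (hK : IsCompact K) {g : X → Y → ℝ} (hg : Continuous (Function.uncurry g))
    {b : X → Y} (hbK : ∀ x, b x ∈ K) (hb : ∀ x, IsMinOn (g x) K (b x))
    (huniq : ∀ x, ∀ y ∈ K, IsMinOn (g x) K y → y = b x) : Continuous b := by
  rw [continuous_iff_continuousAt]
  intro x₀ U hU
  obtain ⟨V, hVU, hV, hbV⟩ := mem_nhds_iff.1 hU
  have hlt : ∀ y ∈ K \ V, g x₀ (b x₀) < g x₀ y := by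
    intro y hy
    by_contra! hle
    exact hy.2 (huniq x₀ y hy.1 (fun z hz => hle.trans (hb x₀ hz)) ▸ hbV)
  have hopen : IsOpen {q : X × Y | g q.1 (b x₀) < g q.1 q.2} :=
    isOpen_lt (hg.comp (continuous_fst.prodMk continuous_const)) hg
  have hev : ∀ᶠ x in 𝓝 x₀, ∀ y ∈ K \ V, g x (b x₀) < g x y := by
    refine (hK.diff hV).eventually_forall_of_forall_eventually fun y hy => ?_
    exact hopen.mem_nhds (hlt y hy)
  refine Filter.mem_map.2 (Filter.mem_of_superset hev fun x hx => ?_)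
  by_contra hbx
  exact absurd (hb x (hbK x₀)) (not_le.2 (hx (b x) ⟨hbK x, fun h => hbx (hVU h)⟩))

open Set in
/-- A game on a box in which every player minimizes a jointly continuous cost, strictly convex in
the player's own strategy, has a pure Nash equilibrium. -/
theorem exists_nash_of_strictConvexOn_box {ι : Type*} [Fintype ι] [DecidableEq ι] {M : ι → ℝ}
    (hM : ∀ i, 0 ≤ M i) {φ : ι → (ι → ℝ) → ℝ} (hφ : ∀ i, ContinuousOn (φ i) (Icc 0 M))
    (hconv : ∀ i, ∀ x ∈ Icc 0 M,
      StrictConvexOn ℝ (Icc 0 (M i)) fun y => φ i (Function.update x i y)) :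
    ∃ x ∈ Icc 0 M, ∀ i, ∀ y ∈ Icc 0 (M i), φ i x ≤ φ i (Function.update x i y) := by
  -- Clamping to the box defines best responses on the whole space, giving a bounded self-map to
  -- which Brouwer applies.
  let p : (ι → ℝ) → ι → ℝ := fun x j => max 0 (min (M j) (x j))
  have hpc : Continuous p := by fun_prop
  have hp : ∀ x, p x ∈ Icc 0 M := fun x =>
    ⟨fun j => le_max_left _ _, fun j => max_le (hM j) (min_le_left _ _)⟩
  have hp1 : ∀ {j} {y : ℝ}, y ∈ Icc 0 (M j) → max 0 (min (M j) y) = y := fun {j y} hy => by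
    rw [min_eq_right hy.2, max_eq_right hy.1]
  have hpx : ∀ x ∈ Icc 0 M, p x = x := fun x hx => funext fun j => hp1 ⟨hx.1 j, hx.2 j⟩
  let g : ι → (ι → ℝ) → ℝ → ℝ := fun i x y => φ i (p (Function.update x i y))
  have hgc : ∀ i, Continuous (Function.uncurry (g i)) := fun i =>
    (hφ i).comp_continuous (hpc.comp (continuous_fst.update i continuous_snd)) fun _ => hp _
  have hpu : ∀ i x, ∀ y ∈ Icc 0 (M i),
      p (Function.update x i y) = Function.update (p x) i y := by
    intro i x y hy
    ext j
    rcases eq_or_ne j i with rfl | hj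
    · simp [p, hp1 hy]
    · simp [p, hj]
  have hgconv : ∀ i x, StrictConvexOn ℝ (Icc 0 (M i)) (g i x) := fun i x =>
    (hconv i (p x) (hp x)).congr fun y hy => by simp only [g, hpu i x y hy]
  have hmin : ∀ i x, ∃ y ∈ Icc 0 (M i), IsMinOn (g i x) (Icc 0 (M i)) y := fun i x =>
    isCompact_Icc.exists_isMinOn ⟨0, le_rfl, hM i⟩
      ((hgc i).comp (continuous_const.prodMk continuous_id)).continuousOn
  choose b hbK hb using hmin
  have hbc : ∀ i, Continuous (b i) := fun i =>
    continuous_of_unique_isMinOn isCompact_Icc (hgc i) (hbK i) (hb i) fun x y hy hmy =>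
      (hgconv i x).eq_of_isMinOn hmy (hb i x) hy (hbK i x)
  let f : EuclideanSpace ℝ ι → EuclideanSpace ℝ ι := fun x => WithLp.toLp 2 fun i => b i x.ofLp
  have hfc : Continuous f := by
    refine (PiLp.continuous_toLp 2 _).comp (continuous_pi fun i => ?_)
    exact (hbc i).comp (PiLp.continuous_ofLp 2 _)
  obtain ⟨C, hC⟩ := ((isCompact_Icc (a := (0 : ι → ℝ)) (b := M)).image
    (PiLp.continuous_toLp 2 fun _ : ι => ℝ)).isBounded.exists_norm_le
  obtain ⟨x, hx⟩ := hfc.exists_fixedPoint_of_bounded fun x =>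
    hC (f x) ⟨_, ⟨fun i => (hbK i x.ofLp).1, fun i => (hbK i x.ofLp).2⟩, rfl⟩
  have hbx : ∀ i, b i x.ofLp = x.ofLp i := fun i => congrFun (congrArg WithLp.ofLp hx) i
  have hxM : x.ofLp ∈ Icc 0 M :=
    ⟨fun i => (hbx i ▸ hbK i x.ofLp).1, fun i => (hbx i ▸ hbK i x.ofLp).2⟩
  refine ⟨x.ofLp, hxM, fun i y hy => ?_⟩
  have h : g i x.ofLp (b i x.ofLp) ≤ g i x.ofLp y := hb i x.ofLp hy
  simpa only [g, hbx, Function.update_eq_self, hpu i _ y hy, hpx _ hxM] using h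

/-! ### Reduction of the IDS game to a box. -/

theorem update_mem_investmentProfiles {N : ℕ} {x : Fin N → ℝ} (hx : x ∈ investmentProfiles N)
    (j : Fin N) {y : ℝ} (hy : 0 ≤ y) : Function.update x j y ∈ investmentProfiles N := by
  intro k
  rcases eq_or_ne k j with rfl | hk
  · simpa using hy
  · simpa [hk] using hx k

theorem IDSGame.antitoneOn_update {N : ℕ} (G : IDSGame N) (i j : Fin N) {x : Fin N → ℝ}
    (hx : x ∈ investmentProfiles N) :
    AntitoneOn (fun y => G.f i (Function.update x j y)) (Set.Ici 0) := by
  have hneg : ∀ y ∈ Set.Ici (0 : ℝ),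
      derivWithin (fun y => G.f i (Function.update x j y)) (Set.Ici 0) y < 0 := fun y hy => by
    simpa using G.f_decreasing i j _ (update_mem_investmentProfiles hx j hy)
  have hdiff : DifferentiableOn ℝ (fun y => G.f i (Function.update x j y)) (Set.Ici 0) :=
    -- `derivWithin` defaults to 0 where not differentiable, so a negative value already forces
    -- differentiability.
    fun y hy => differentiableWithinAt_of_derivWithin_ne_zero (hneg y hy).ne
  refine antitoneOn_of_deriv_nonpos (convex_Ici 0) hdiff.continuousOn
    (hdiff.mono interior_subset) fun y hy => ?_
  rw [← derivWithin_of_mem_nhds (mem_interior_iff_mem_nhds.1 hy)]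
  exact (hneg y (interior_subset hy)).le

/-- Lower the coordinates to zero one at a time; no step decreases the risk. -/
theorem IDSGame.risk_le_risk_zero {N : ℕ} (G : IDSGame N) (i : Fin N) {x : Fin N → ℝ}
    (hx : x ∈ investmentProfiles N) : G.f i x ≤ G.f i 0 := by
  have h : ∀ S : Finset (Fin N), S.piecewise 0 x ∈ investmentProfiles N ∧
      G.f i x ≤ G.f i (S.piecewise 0 x) := by
    intro S
    induction S using Finset.induction_on with
    | empty => simpa using hx
    | insert j S _ ih =>
      rw [Finset.piecewise_insert]
      refine ⟨update_mem_investmentProfiles ih.1 j le_rfl, ih.2.trans ?_⟩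
      have := G.antitoneOn_update i j ih.1 (Set.mem_Ici.2 le_rfl) (ih.1 j) (ih.1 j)
      simpa using this
  simpa using (h Finset.univ).2

theorem proposition1 (N : ℕ) (G : IDSGame N) :
    ∃ x : Fin N → ℝ, IsPureNashEquilibrium (G.utility (fun _ _ => 0)) x := by
  have h0 : (0 : Fin N → ℝ) ∈ investmentProfiles N := fun _ => le_rfl
  let M : Fin N → ℝ := fun i => G.f i 0 / G.c i
  have hM : ∀ i, 0 ≤ M i := fun i => (div_pos (G.f_pos i 0 h0) (G.c_pos i)).le
  obtain ⟨x, hx, hmin⟩ := exists_nash_of_strictConvexOn_box hM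
    (φ := fun i x => G.f i x + G.c i * x i)
    (fun i => ((G.f_differentiable i).continuousOn.mono fun x hx => hx.1).add (by fun_prop))
    (fun i x hx => by
      refine ((G.f_strictConvex i x hx.1).subset (fun y hy => hy.1) (convex_Icc _ _)).add_convexOn ?_
      simp only [Function.update_self]
      exact ((LinearMap.mulLeft ℝ (G.c i)).convexOn (convex_Icc _ _)))
  refine ⟨x, hx.1, fun i y hy => ?_⟩
  suffices h : G.f i x + G.c i * x i ≤ G.f i (Function.update x i y) + G.c i * y by
    simp only [IDSGame.utility, Function.update_self]
    linarith
  rcases le_or_gt y (M i) with hyM | hyM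
  · simpa using hmin i y ⟨hy, hyM⟩
  -- Beyond the box, the investment alone costs more than `f i 0`, which bounds the cost of
  -- deviating to zero.
  · have h1 := hmin i 0 ⟨le_rfl, hM i⟩
    have h2 := G.risk_le_risk_zero i (update_mem_investmentProfiles hx.1 i le_rfl)
    have h3 := G.f_pos i _ (update_mem_investmentProfiles hx.1 i hy)
    have h4 : G.f i 0 < G.c i * y := by
      rw [mul_comm]
      exact (div_lt_iff₀ (G.c_pos i)).1 hyM
    simp only [Function.update_self, mul_zero, add_zero] at h1
    linarith
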